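/- Let $\rho=2\cdot 5^{-5/8}$ (so $0<\rho<1$), $U=\{t\in\mathbb{C} : |t|<\rho,\ t\notin\mathbb{R}\}$ and $X=\{z\in\mathbb{C} : |z|\le 1/(1-\rho)\}$. For $t\in U$ and $j\ge 1$ let $\phi^{(j)}_{1,t}(z)=tz$ and $\phi^{(j)}_{2,t}(z)=tz+1/j$, $\Phi_t^{(j)}=\{\phi^{(j)}_{1,t},\phi^{(j)}_{2,t}\}$ and $\Phi_t=(\Phi_t^{(j)})_{j\ge1}$. For $n\ge1$ and $\omega=\omega_n\omega_{n+1}\cdots\in I_n^\infty=\prod_{j\ge n}\{1,2\}$ (with the product topology) write $\phi_{\omega|_j,t}=\phi^{(n)}_{\omega_n,t}\circ\cdots\circ\phi^{(n+j-1)}_{\omega_{n+j-1},t}$. Then: (a) $\{\Phi_t\}_{t\in U}$ is a transversal family of non-autonomous conformal iterated function systems (TNCIFS) on $X$, that is: $X$ is non-empty, compact and convex, $U$ is non-empty and open, all maps send $X$ into $X$, and 1. (Conformality) there is an open connected set $V\supset X$, independent of $i,j,t$, such that every $\phi^{(j)}_{i,t}$ extends to a $C^1$ conformal map on $V$ (a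 $C^1$ diffeomorphism onto its image whose derivative at each point is a positive multiple of an orthogonal map) with $\phi^{(j)}_{i,t}(V)\subset V$; for conformal $\phi$ let $|D\phi(x)|$ be the scaling factor of $D\phi(x)$ and $\|D\phi\|_X=\sup_{x\in X}|D\phi(x)|$; 2. (Uniform contraction) there is $0<\gamma<1$ with $|D\phi_{\omega|_j,t}(x)|\le\gamma^j$ for all $t\in U$, $n,j\ge1$, $\omega\in I_n^\infty$, $x\in V$; 3. (Bounded distortion) there is a continuous $K:U\to[1,\infty)$ with $|D\phi_{\omega|_j,t}(x_1)|\le K(t)|D\phi_{\omega|_j,t}(x_2)|$ for all $t\in U$, $n,j\ge1$, $\omega\in I_n^\infty$, $x_1,x_2\in V$; 4. (Distortion continuity) for all $\eta>0$ and $t_0\in U$ there is $\delta>0$ such that $e^{-j\eta}\le\|D\phi_{\omega|_j,t_0}\|_X/\|D\phi_{\omega|_j,t}\|_X\le e^{j\eta}$ for all $t\in U$ with $|t-t_0|\le\delta$, all $n,j\ge1$ and all $\omega\in I_n^\infty$; 5. (Continuity) for every $n\ge1$, with $\pi_{n,t}(\omega)$ denoting the unique point of $\bigcap_{j\ge1}\phi_{\omega|_j,t}(X)$,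 the map $(t,\omega)\mapsto\pi_{n,t}(\omega)$ is continuous on $U\times I_n^\infty$; 6. (Transversality) for every compact $G\subset U$ there are constants $C_n>0$ with $\lim_{n\to\infty}\frac1n\log C_n=0$ such that for all $n\ge1$, all $\omega,\tau\in I_n^\infty$ with $\omega_n\ne\tau_n$ and all $r>0$, $\mathcal{L}_2(\{t\in G : |\pi_{n,t}(\omega)-\pi_{n,t}(\tau)|\le r\})\le C_n r^2$, where $\mathcal{L}_2$ is Lebesgue measure on $\mathbb{C}=\mathbb{R}^2$. (b) For no $t\in U$ does $\Phi_t$ satisfy the open set condition: for every $t\in U$ and every compact $Y\subset\mathbb{C}$ with non-empty interior (in particular for $Y=X$), it is not true that $\phi^{(j)}_{1,t}(\mathrm{int}\,Y)\cap\phi^{(j)}_{2,t}(\mathrm{int}\,Y)=\emptyset$ for all $j\ge1$. (c) In the transversality condition one can take $C_n=Kn^2$, where the constant $K>0$ depends only on $G$. -/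

import Mathlib

open Set Filter Topology MeasureTheory

namespace NIFS

/-- The symbolic space of infinite words `ω_n ω_{n+1} ⋯` with `ω_j ∈ I j` for every `j ≥ n`; the
letter `ω_{n+k}` is written `ω k`. For discrete `I j` it carries the product topology. -/
abbrev Tail (I : ℕ → Type*) (n : ℕ) := ∀ k : ℕ, I (n + k)

/-- For `f = (f j i)` and a word `ω = ω_n ω_{n+1} ⋯`, `word f ω j` is the composition
`f n ω_n ∘ f (n+1) ω_{n+1} ∘ ⋯ ∘ f (n+j-1) ω_{n+j-1}` along the first `j` letters of `ω`. -/
def word {I : ℕ → Type*} {E : Type*} (f : ∀ j, I j → E → E) {n : ℕ} (ω : Tail I n) : ℕ → E → E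
  | 0 => id
  | j + 1 => word f ω j ∘ f (n + j) (ω j)

/-- The open set condition on `X` for a non-autonomous system `(f j i)`, `j ≥ 1`. -/
def OpenSetCondition {I : ℕ → Type*} {E : Type*} [TopologicalSpace E] (X : Set E)
    (f : ∀ j, I j → E → E) : Prop :=
  ∀ j, 1 ≤ j → ∀ a b : I j, a ≠ b → f j a '' interior X ∩ f j b '' interior X = ∅

section General

variable {E : Type*} [NormedAddCommGroup E] [InnerProductSpace ℝ E]

/-- `f` restricts to a `C¹` diffeomorphism of the open set `V` onto the open set `f '' V`, whose
derivative at every point of `V` is a nonzero multiple of a linear isometry. -/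
structure IsConformalOn (f : E → E) (V : Set E) : Prop where
  contDiffOn : ContDiffOn ℝ 1 f V
  isOpen_image : IsOpen (f '' V)
  exists_inverse : ∃ g : E → E, ContDiffOn ℝ 1 g (f '' V) ∧ LeftInvOn g f V
  conformalAt : ∀ x ∈ V, ConformalAt f x

/-- The scaling factor `|Df(x)|` of a conformal map `f` at `x`; see `scaling_eq`. -/
noncomputable def scaling (f : E → E) (x : E) : ℝ := ‖fderiv ℝ f x‖

theorem scaling_eq [Nontrivial E] {f : E → E} {x : E} {c : ℝ} (hc : 0 < c) (A : E →ₗᵢ[ℝ] E)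
    (h : HasFDerivAt f (c • A.toContinuousLinearMap) x) : scaling f x = c := by
  rw [scaling, h.fderiv, norm_smul, LinearIsometry.norm_toContinuousLinearMap, mul_one,
    Real.norm_of_nonneg hc.le]

/-- `‖Df‖_A`, the supremum of the scaling factors of `f` over `A`. -/
noncomputable def scalingSup (f : E → E) (A : Set E) : ℝ := sSup (scaling f '' A)

/-- The address of `ω`: the unique point of the intersection of the sets
`f_{ω_n} ∘ ⋯ ∘ f_{ω_{n+j-1}} (X)`, `j ≥ 1` (arbitrary if that is not a single point). -/
noncomputable def address {I : ℕ → Type*} (X : Set E) (f : ∀ j, I j → E → E) {n : ℕ}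
    (ω : Tail I n) : E :=
  Classical.epsilon fun x => ⋂ j ∈ Ici 1, word f ω j '' X = {x}

variable {F : Type*} [NormedAddCommGroup F] [InnerProductSpace ℝ F] [FiniteDimensional ℝ F]
  [MeasurableSpace F] [BorelSpace F]

/-- For each `n ≥ 1`, each pair of words `ω, τ` starting at level `n` with different first letters
and each `r > 0`, the Lebesgue measure of the set of those `t ∈ G` for which the addresses of `ω`
and `τ` are at distance at most `r` is at most `C n * r ^ m`, where `m = dim E`. -/
def TransversalWith {I : ℕ → Type*} (X : Set E) (φ : F → ∀ j, I j → E → E) (G : Set F)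
    (C : ℕ → ℝ) : Prop :=
  ∀ n, 1 ≤ n → ∀ ω τ : Tail I n, ω 0 ≠ τ 0 → ∀ r : ℝ, 0 < r →
    volume {t ∈ G | ‖address X (φ t) ω - address X (φ t) τ‖ ≤ r} ≤
      ENNReal.ofReal (C n * r ^ Module.finrank ℝ E)

/-- The conditions 1-4 on a parametrized family: `ψ` extends the family `φ` of self-maps of `X` to
the open connected set `V ⊇ X`, where it has the properties of conformality, uniform contraction,
bounded distortion and distortion continuity. -/
structure IsConformalExtension {I : ℕ → Type*} (X : Set E) (U : Set F)
    (φ : F → ∀ j, I j → E → E) (V : Set E) (ψ : F → ∀ j, I j → E → E) : Prop where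
  isOpen : IsOpen V
  isConnected : IsConnected V
  subset : X ⊆ V
  extends_map : ∀ t ∈ U, ∀ j, 1 ≤ j → ∀ i, EqOn (ψ t j i) (φ t j i) X
  conformal : ∀ t ∈ U, ∀ j, 1 ≤ j → ∀ i, IsConformalOn (ψ t j i) V
  mapsTo : ∀ t ∈ U, ∀ j, 1 ≤ j → ∀ i, MapsTo (ψ t j i) V V
  uniform_contraction : ∃ γ : ℝ, 0 < γ ∧ γ < 1 ∧ ∀ t ∈ U, ∀ n, 1 ≤ n → ∀ ω : Tail I n,
    ∀ j, 1 ≤ j → ∀ x ∈ V, scaling (word (ψ t) ω j) x ≤ γ ^ j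
  bounded_distortion : ∃ K : F → ℝ, ContinuousOn K U ∧ (∀ t ∈ U, 1 ≤ K t) ∧
    ∀ t ∈ U, ∀ n, 1 ≤ n → ∀ ω : Tail I n, ∀ j, 1 ≤ j → ∀ x₁ ∈ V, ∀ x₂ ∈ V,
      scaling (word (ψ t) ω j) x₁ ≤ K t * scaling (word (ψ t) ω j) x₂
  distortion_continuity : ∀ η : ℝ, 0 < η → ∀ t₀ ∈ U, ∃ δ : ℝ, 0 < δ ∧
    ∀ t ∈ U, ‖t - t₀‖ ≤ δ → ∀ n, 1 ≤ n → ∀ j : ℕ, 1 ≤ j → ∀ ω : Tail I n,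
      Real.exp (-(j * η)) ≤ scalingSup (word (ψ t₀) ω j) X / scalingSup (word (ψ t) ω j) X ∧
      scalingSup (word (ψ t₀) ω j) X / scalingSup (word (ψ t) ω j) X ≤ Real.exp (j * η)

/-- Transversal family of non-autonomous conformal iterated function systems on `X`, with parameter
set `U`; level `j ≥ 1` of the system with parameter `t` is `(φ t j i)`, `i ∈ I j`. -/
structure IsTNCIFS {I : ℕ → Type*} [∀ j, Finite (I j)] [∀ j, TopologicalSpace (I j)]
    [∀ j, DiscreteTopology (I j)] [FiniteDimensional ℝ E] [Nontrivial E] [Nontrivial F]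
    (X : Set E) (U : Set F) (φ : F → ∀ j, I j → E → E) : Prop where
  nonempty : X.Nonempty
  isCompact : IsCompact X
  convex : Convex ℝ X
  param_nonempty : U.Nonempty
  param_isOpen : IsOpen U
  mapsTo : ∀ t ∈ U, ∀ j, 1 ≤ j → ∀ i, MapsTo (φ t j i) X X
  extension : ∃ (V : Set E) (ψ : F → ∀ j, I j → E → E), IsConformalExtension X U φ V ψ
  /-- The address map is well defined. -/
  address_spec : ∀ t ∈ U, ∀ n, 1 ≤ n → ∀ ω : Tail I n,
    ⋂ j ∈ Ici 1, word (φ t) ω j '' X = {address X (φ t) ω}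
  continuity : ∀ n, 1 ≤ n →
    ContinuousOn (fun p : F × Tail I n => address X (φ p.1) p.2) (U ×ˢ univ)
  transversality : ∀ G : Set F, IsCompact G → G ⊆ U → ∃ C : ℕ → ℝ,
    (∀ n, 1 ≤ n → 0 < C n) ∧ Tendsto (fun n : ℕ => Real.log (C n) / n) atTop (𝓝 0) ∧
    TransversalWith X φ G C

end General

/-- The number `2 · 5^{-5/8}`. -/
noncomputable def ρ : ℝ := 2 * (5 : ℝ) ^ (-(5 / 8) : ℝ)

/-- The parameter set: non-real complex numbers of modulus less than `2 · 5^{-5/8}`. -/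
def exampleU : Set ℂ := {t | ‖t‖ < ρ ∧ t ∉ range ((↑) : ℝ → ℂ)}

/-- The closed disc of radius `1 / (1 - 2 · 5^{-5/8})` about `0`. -/
def exampleX : Set ℂ := {z | ‖z‖ ≤ 1 / (1 - ρ)}

/-- The family whose level `j ≥ 1` consists of `z ↦ t z` and `z ↦ t z + 1 / j`. -/
noncomputable def exampleMap (t : ℂ) (j : ℕ) : Fin 2 → ℂ → ℂ :=
  ![fun z => t * z, fun z => t * z + 1 / (j : ℂ)]

end NIFS

/-! For words with different first letters, `n` times the difference of the two addresses is, up to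
sign, a power series in `t` with real coefficients in `[-1, 1]` and constant term `1`
(`exists_realSeries_eq`). Transversality is thus a quantitative form of the fact that such series
have no double zeros in `U`.

That fact is a Jensen-type estimate (`le_norm_pow_of_double_zero`). A nonreal double zero `t` of a
real series `p` comes with the double zero `conj t`, so `p = (X - t)² (X - conj t)² L`. Replacing
each factor `X - a` by its mirror image `s - conj a X` multiplies the squared Hardy norm on the
circle `|z|² = s` by exactly `s`. The norm of the result is at least its constant term, `s⁴ |L(0)| =
s⁴ / |t|⁴`, while the squared norm of `p` is at most `1 / (1 - s)`. Hence `|t|⁸ ≥ s⁴ (1 - s)`, and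
the choice `s = 4/5` gives `|t| ≥ ρ`.

Compactness of the coefficient space makes this uniform over a compact `G ⊆ U`: near almost zeros
every such series expands distances by a fixed factor (`exists_lower_bound`). A covering argument
then bounds the measure of `{|p| ≤ r}` by a constant times `r²`. Undoing the factor `n` replaces `r`
by `n r`, which produces `C n = K n²`, of subexponential growth.

The remaining conditions are easy because all maps at the parameter `t` have derivative `t`. The
open set condition fails because the translations `1 / j` tend to `0`. -/

namespace NIFS

/-! ### Division by linear factors and the bound on double zeros. -/

section PowerSeriesOnDisc

open PowerSeries ComplexConjugate

/-- Power series with bounded coefficients; they converge on the open unit disc. -/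
def BoundedCoeff (p : PowerSeries ℂ) : Prop := ∃ M : ℝ, ∀ k, ‖coeff k p‖ ≤ M

/-- The value at `z` of the sum of a power series. -/
noncomputable def evalAt (p : PowerSeries ℂ) (z : ℂ) : ℂ := ∑' k, coeff k p * z ^ k

/-- The quotient of `p - p(x)` by `X - x`. -/
noncomputable def divLinear (p : PowerSeries ℂ) (x : ℂ) : PowerSeries ℂ :=
  PowerSeries.mk fun k => ∑' m, coeff (k + 1 + m) p * x ^ m

/-- The squared norm of `p` in the Hardy space of the disc of radius `√s`. -/
noncomputable def hardySq (s : ℝ) (p : PowerSeries ℂ) : ℝ := ∑' k, ‖coeff k p‖ ^ 2 * s ^ k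

theorem summable_mul_pow {c : ℕ → ℂ} {M : ℝ} (hc : ∀ k, ‖c k‖ ≤ M) {z : ℂ} (hz : ‖z‖ < 1) :
    Summable fun k => c k * z ^ k := by
  refine Summable.of_norm_bounded
    ((summable_geometric_of_lt_one (norm_nonneg z) hz).mul_left M) fun k => ?_
  rw [norm_mul, norm_pow]
  exact mul_le_mul_of_nonneg_right (hc k) (by positivity)

theorem norm_tsum_mul_pow_le {c : ℕ → ℂ} {M : ℝ} (hc : ∀ k, ‖c k‖ ≤ M) {z : ℂ} (hz : ‖z‖ < 1) :
    ‖∑' k, c k * z ^ k‖ ≤ M * (1 - ‖z‖)⁻¹ := by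
  refine tsum_of_norm_bounded ((hasSum_geometric_of_lt_one (norm_nonneg z) hz).mul_left M)
    fun k => ?_
  rw [norm_mul, norm_pow]
  exact mul_le_mul_of_nonneg_right (hc k) (by positivity)

theorem BoundedCoeff.summable {p : PowerSeries ℂ} (hp : BoundedCoeff p) {z : ℂ} (hz : ‖z‖ < 1) :
    Summable fun k => coeff k p * z ^ k :=
  let ⟨_, hM⟩ := hp
  summable_mul_pow hM hz

theorem BoundedCoeff.sub {p q : PowerSeries ℂ} (hp : BoundedCoeff p) (hq : BoundedCoeff q) :
    BoundedCoeff (p - q) := by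
  obtain ⟨M, hM⟩ := hp
  obtain ⟨M', hM'⟩ := hq
  refine ⟨M + M', fun k => ?_⟩
  rw [map_sub]
  exact (norm_sub_le _ _).trans (add_le_add (hM k) (hM' k))

theorem BoundedCoeff.C_mul {p : PowerSeries ℂ} (hp : BoundedCoeff p) (a : ℂ) :
    BoundedCoeff (C a * p) := by
  obtain ⟨M, hM⟩ := hp
  refine ⟨‖a‖ * M, fun k => ?_⟩
  rw [coeff_C_mul, norm_mul]
  exact mul_le_mul_of_nonneg_left (hM k) (norm_nonneg a)

theorem BoundedCoeff.X_mul {p : PowerSeries ℂ} (hp : BoundedCoeff p) :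
    BoundedCoeff (X * p) := by
  obtain ⟨M, hM⟩ := hp
  refine ⟨M, fun k => ?_⟩
  cases k with
  | zero => simpa using (norm_nonneg _).trans (hM 0)
  | succ k => rw [coeff_succ_X_mul]; exact hM k

theorem BoundedCoeff.C_sub_mul {p : PowerSeries ℂ} (hp : BoundedCoeff p) (s a : ℂ) :
    BoundedCoeff ((C s - C a * X) * p) := by
  rw [sub_mul, mul_assoc]
  exact (hp.C_mul s).sub (hp.X_mul.C_mul a)

theorem BoundedCoeff.X_sub_C_mul {p : PowerSeries ℂ} (hp : BoundedCoeff p) (a : ℂ) :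
    BoundedCoeff ((X - C a) * p) := by
  rw [sub_mul]
  exact hp.X_mul.sub (hp.C_mul a)

theorem BoundedCoeff.divLinear {p : PowerSeries ℂ} (hp : BoundedCoeff p) {x : ℂ} (hx : ‖x‖ < 1) :
    BoundedCoeff (divLinear p x) := by
  obtain ⟨M, hM⟩ := hp
  refine ⟨M * (1 - ‖x‖)⁻¹, fun k => ?_⟩
  rw [NIFS.divLinear, coeff_mk]
  exact norm_tsum_mul_pow_le (fun m => hM _) hx

/-- Splitting off the first term of the tail sum `d k` that defines the quotient gives `d k = c (k +
1) + x * d (k + 1)`, which is the identity coefficient by coefficient. -/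
theorem sub_C_eq_mul_divLinear {p : PowerSeries ℂ} (hp : BoundedCoeff p) {x : ℂ} (hx : ‖x‖ < 1) :
    p - C (evalAt p x) = (X - C x) * divLinear p x := by
  have hp' := hp
  obtain ⟨M, hM⟩ := hp
  ext k
  rw [sub_mul, map_sub, map_sub, coeff_C_mul]
  cases k with
  | zero =>
    have h := (hp'.summable hx).tsum_eq_zero_add
    simp only [evalAt, divLinear, coeff_mk, coeff_zero_X_mul, coeff_C, if_true, h, pow_zero, mul_one,
      ← tsum_mul_left]
    simp only [pow_succ', add_comm, zero_add, mul_left_comm x]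
    ring
  | succ k =>
    have hs : Summable fun m => coeff (k + 1 + m) p * x ^ m := summable_mul_pow (fun m => hM _) hx
    simp only [divLinear, coeff_mk, coeff_succ_X_mul, coeff_C, hs.tsum_eq_zero_add, ← tsum_mul_left]
    simp only [pow_succ', mul_left_comm x]
    simp [add_comm, add_left_comm]

theorem evalAt_X_sub_C_mul {p : PowerSeries ℂ} (hp : BoundedCoeff p) (a : ℂ) {z : ℂ}
    (hz : ‖z‖ < 1) : evalAt ((X - C a) * p) z = (z - a) * evalAt p z := by
  have hX : evalAt (X * p) z = z * evalAt p z := by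
    rw [evalAt, (hp.X_mul.summable hz).tsum_eq_zero_add, evalAt, ← tsum_mul_left]
    simp only [coeff_zero_X_mul, coeff_succ_X_mul, pow_succ', zero_mul, zero_add, mul_left_comm z]
  have hC : evalAt (C a * p) z = a * evalAt p z := by
    rw [evalAt, evalAt, ← tsum_mul_left]
    simp only [coeff_C_mul, mul_assoc]
  rw [sub_mul, sub_mul z, ← hX, ← hC, evalAt, evalAt, evalAt,
    ← (hp.X_mul.summable hz).tsum_sub ((hp.C_mul a).summable hz)]
  simp only [map_sub, sub_mul]

/-- The quotient is a difference quotient that still makes sense at `y = x`, where it is the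
derivative. So `p(x) = 0` together with `(divLinear p x)(x) = 0` expresses a double zero without
derivatives. -/
theorem evalAt_sub_evalAt {p : PowerSeries ℂ} (hp : BoundedCoeff p) {x y : ℂ} (hx : ‖x‖ < 1)
    (hy : ‖y‖ < 1) : evalAt p y - evalAt p x = (y - x) * evalAt (divLinear p x) y := by
  rw [← evalAt_X_sub_C_mul (hp.divLinear hx) x hy, ← sub_C_eq_mul_divLinear hp hx]
  have hC : ∑' k, coeff k (C (evalAt p x)) * y ^ k = evalAt p x := by
    rw [tsum_eq_single 0 fun k hk => by simp [coeff_C, hk]]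
    simp
  have hCs : Summable fun k => coeff k (C (evalAt p x)) * y ^ k :=
    summable_of_ne_finset_zero (s := {0}) fun k hk => by
      simp [coeff_C, Finset.notMem_singleton.mp hk]
  change _ = ∑' k, coeff k (p - C (evalAt p x)) * y ^ k
  simp only [map_sub, sub_mul]
  rw [(hp.summable hy).tsum_sub hCs, hC]
  rfl

theorem eq_X_sub_C_mul_divLinear {p : PowerSeries ℂ} (hp : BoundedCoeff p) {x : ℂ} (hx : ‖x‖ < 1)
    (h : evalAt p x = 0) : p = (X - C x) * divLinear p x := by
  rw [← sub_C_eq_mul_divLinear hp hx, h, map_zero, sub_zero]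

theorem evalAt_divLinear_eq_zero {p : PowerSeries ℂ} (hp : BoundedCoeff p) {x y : ℂ} (hx : ‖x‖ < 1)
    (hy : ‖y‖ < 1) (hxy : y ≠ x) (h : evalAt p x = 0) (h' : evalAt p y = 0) :
    evalAt (divLinear p x) y = 0 := by
  have := evalAt_sub_evalAt hp hx hy
  rw [h, h', sub_zero, eq_comm, mul_eq_zero, sub_eq_zero] at this
  exact this.resolve_left hxy

theorem evalAt_conj {p : PowerSeries ℂ} (hp : PowerSeries.map (starRingEnd ℂ) p = p) (z : ℂ) :
    evalAt p (conj z) = conj (evalAt p z) := by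
  rw [evalAt, evalAt, Complex.conj_tsum]
  refine tsum_congr fun k => ?_
  rw [map_mul, map_pow, ← PowerSeries.coeff_map, hp]

theorem BoundedCoeff.summable_hardySq {p : PowerSeries ℂ} (hp : BoundedCoeff p) {s : ℝ}
    (hs : 0 ≤ s) (hs1 : s < 1) : Summable fun k => ‖coeff k p‖ ^ 2 * s ^ k := by
  obtain ⟨M, hM⟩ := hp
  refine Summable.of_nonneg_of_le (fun k => by positivity) (fun k => ?_)
    ((summable_geometric_of_lt_one hs hs1).mul_left (M ^ 2))
  gcongr
  exact hM k

/-- A Blaschke factor is unimodular on the circle of radius `√s`. -/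
theorem hardySq_X_sub_C_mul {p : PowerSeries ℂ} (hp : BoundedCoeff p) {s : ℝ} (hs : 0 < s)
    (hs1 : s < 1) (a : ℂ) :
    s * hardySq s ((X - C a) * p) = hardySq s ((C (s : ℂ) - C (conj a) * X) * p) := by
  have h1 := ((hp.X_sub_C_mul a).summable_hardySq hs.le hs1).mul_left s
  have h2 := (hp.C_sub_mul s (conj a)).summable_hardySq hs.le hs1
  -- The two sides differ in the term of index `k + 1` by `w (k + 1) - w k` and in the term of index
  -- `0` by `w 0`, so the sum of the differences telescopes to `0`.
  set w : ℕ → ℝ := fun k => (s * ‖a‖ ^ 2 - s ^ 2) * (‖coeff k p‖ ^ 2 * s ^ k) with hw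
  have hws : Summable w := (hp.summable_hardySq hs.le hs1).mul_left _
  rw [hardySq, hardySq, ← tsum_mul_left, ← sub_eq_zero, ← h1.tsum_sub h2,
    (h1.sub h2).tsum_eq_zero_add]
  have key : ∀ k, s * (‖coeff (k + 1) ((X - C a) * p)‖ ^ 2 * s ^ (k + 1)) -
      ‖coeff (k + 1) ((C (s : ℂ) - C (conj a) * X) * p)‖ ^ 2 * s ^ (k + 1) = w (k + 1) - w k := by
    intro k
    rw [sub_mul, sub_mul, mul_assoc, map_sub, map_sub, coeff_C_mul, coeff_C_mul, coeff_C_mul,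
      coeff_succ_X_mul]
    simp only [hw, Complex.sq_norm, Complex.normSq_apply, Complex.sub_re, Complex.sub_im,
      Complex.mul_re, Complex.mul_im, Complex.ofReal_re, Complex.ofReal_im, Complex.conj_re,
      Complex.conj_im]
    ring
  rw [tsum_congr key, ((summable_nat_add_iff 1).2 hws).tsum_sub hws, hws.tsum_eq_zero_add]
  simp only [sub_mul, mul_assoc, map_sub, coeff_C_mul, coeff_zero_X_mul, hw, zero_sub, norm_neg,
    mul_zero, sub_zero, norm_mul, Complex.norm_real, Real.norm_of_nonneg hs.le]
  ring

theorem sq_norm_coeff_zero_le_hardySq {p : PowerSeries ℂ} (hp : BoundedCoeff p) {s : ℝ}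
    (hs : 0 ≤ s) (hs1 : s < 1) : ‖coeff 0 p‖ ^ 2 ≤ hardySq s p := by
  have := (hp.summable_hardySq hs hs1).le_tsum 0 fun k _ => by positivity
  rwa [pow_zero, mul_one] at this

/-- A real power series with constant term `1` and coefficients in `[-1, 1]` has no multiple zero
`t` off the real line with `‖t‖ < 2 · 5^{-5/8}`. -/
theorem le_norm_pow_of_double_zero {p : PowerSeries ℂ}
    (hreal : PowerSeries.map (starRingEnd ℂ) p = p)
    (h0 : coeff 0 p = 1) (h1 : ∀ k, ‖coeff k p‖ ≤ 1) {t : ℂ} (ht : ‖t‖ < 1) (him : conj t ≠ t)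
    (hz : evalAt p t = 0) (hz' : evalAt (divLinear p t) t = 0) :
    256 / 3125 ≤ ‖t‖ ^ 8 := by
  have hp : BoundedCoeff p := ⟨1, h1⟩
  have ht' : ‖conj t‖ < 1 := by rwa [RCLike.norm_conj]
  have hzc : evalAt p (conj t) = 0 := by rw [evalAt_conj hreal, hz, map_zero]
  set h := divLinear p t with hh
  have hb : BoundedCoeff h := hp.divLinear ht
  have hc : evalAt h (conj t) = 0 := evalAt_divLinear_eq_zero hp ht ht' him hz hzc
  have e1 : p = (X - C t) * h := eq_X_sub_C_mul_divLinear hp ht hz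
  set H := divLinear h (conj t) with hH
  have hHb : BoundedCoeff H := hb.divLinear ht'
  have e2 : h = (X - C (conj t)) * H := eq_X_sub_C_mul_divLinear hb ht' hc
  have hHt : evalAt H t = 0 := evalAt_divLinear_eq_zero hb ht' ht him.symm hc hz'
  -- `H` is the quotient of `p` by the real polynomial `(X - t)(X - conj t)`, hence real, although
  -- `h` need not be. This yields the second zero at `conj t`.
  have hHr : PowerSeries.map (starRingEnd ℂ) H = H := by
    have h2 : ∀ a : ℂ, (X - C a : PowerSeries ℂ) ≠ 0 := fun a h => by
      have := congrArg (coeff 1) h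
      simp at this
    refine mul_left_cancel₀ (mul_ne_zero (h2 t) (h2 (conj t))) ?_
    have h3 := hreal
    rw [e1, e2, map_mul, map_mul, map_sub, map_sub, PowerSeries.map_X, PowerSeries.map_C,
      PowerSeries.map_C, Complex.conj_conj] at h3
    linear_combination h3
  have hHc : evalAt H (conj t) = 0 := by rw [evalAt_conj hHr, hHt, map_zero]
  set J := divLinear H t with hJ
  have hJb : BoundedCoeff J := hHb.divLinear ht
  have e3 : H = (X - C t) * J := eq_X_sub_C_mul_divLinear hHb ht hHt
  have hJc : evalAt J (conj t) = 0 := evalAt_divLinear_eq_zero hHb ht ht' him hHt hHc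
  set L := divLinear J (conj t) with hL
  have hLb : BoundedCoeff L := hJb.divLinear ht'
  have e4 : J = (X - C (conj t)) * L := eq_X_sub_C_mul_divLinear hJb ht' hJc
  -- The point of `(0, 1)` at which `s⁴ (1 - s)` is maximal; the maximum is `256 / 3125`.
  set s : ℝ := 4 / 5 with hs
  have hs0 : 0 < s := by norm_num [hs]
  have hs1 : s < 1 := by norm_num [hs]
  set A := C (s : ℂ) - C (conj t) * X with hA
  set B := C (s : ℂ) - C t * X with hB
  -- The four linear factors are reflected one at a time, each at the cost of a factor `s`.
  have hN : s ^ 4 * hardySq s p = hardySq s (B * (A * (B * (A * L)))) := by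
    have s1 : s * hardySq s p = hardySq s ((X - C (conj t)) * (A * H)) := by
      rw [e1, hardySq_X_sub_C_mul hb hs0 hs1, e2]
      congr 1; ring
    have s2 : s * hardySq s ((X - C (conj t)) * (A * H)) =
        hardySq s ((X - C t) * (B * (A * J))) := by
      rw [hardySq_X_sub_C_mul (hHb.C_sub_mul _ _) hs0 hs1, Complex.conj_conj, e3]
      congr 1; ring
    have s3 : s * hardySq s ((X - C t) * (B * (A * J))) =
        hardySq s ((X - C (conj t)) * (A * (B * (A * L)))) := by
      rw [hardySq_X_sub_C_mul ((hJb.C_sub_mul _ _).C_sub_mul _ _) hs0 hs1, e4]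
      congr 1; ring
    have s4 : s * hardySq s ((X - C (conj t)) * (A * (B * (A * L)))) =
        hardySq s (B * (A * (B * (A * L)))) := by
      rw [hardySq_X_sub_C_mul (((hLb.C_sub_mul _ _).C_sub_mul _ _).C_sub_mul _ _) hs0 hs1,
        Complex.conj_conj]
    rw [← s4, ← s3, ← s2, ← s1]
    ring
  have hle : hardySq s p ≤ 5 := by
    have h5 : HasSum (fun k => s ^ k) (1 - s)⁻¹ := hasSum_geometric_of_lt_one hs0.le hs1
    have h6 : hardySq s p ≤ ∑' k, s ^ k := by
      refine (hp.summable_hardySq hs0.le hs1).tsum_le_tsum (fun k => ?_) h5.summable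
      exact mul_le_of_le_one_left (by positivity) (pow_le_one₀ (norm_nonneg _) (h1 k))
    rw [h5.tsum_eq] at h6
    exact h6.trans (by norm_num [hs])
  have hlow := sq_norm_coeff_zero_le_hardySq
    ((((hLb.C_sub_mul s (conj t)).C_sub_mul s t).C_sub_mul s (conj t)).C_sub_mul s t) hs0.le hs1
  rw [← hN] at hlow
  have hL0 : 1 = ‖t‖ ^ 4 * ‖coeff 0 L‖ := by
    have : coeff 0 p = t * (conj t * (t * (conj t * coeff 0 L))) := by
      rw [e1, e2, e3, e4]
      simp
    rw [h0] at this
    have h7 := congrArg norm this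
    simp only [norm_mul, RCLike.norm_conj, norm_one] at h7
    rw [h7]; ring
  have hcoeff : ‖coeff 0 (B * (A * (B * (A * L))))‖ = s ^ 4 * ‖coeff 0 L‖ := by
    have : coeff 0 (B * (A * (B * (A * L)))) = (s : ℂ) ^ 4 * coeff 0 L := by
      simp [hA, hB]
      ring
    rw [this, norm_mul, norm_pow, Complex.norm_real, Real.norm_of_nonneg hs0.le]
  rw [hcoeff] at hlow
  have h8 : s ^ 8 * ‖coeff 0 L‖ ^ 2 ≤ s ^ 4 * 5 := by
    calc s ^ 8 * ‖coeff 0 L‖ ^ 2 = (s ^ 4 * ‖coeff 0 L‖) ^ 2 := by ring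
      _ ≤ _ := hlow
      _ ≤ _ := by gcongr
  have h9 : s ^ 8 ≤ s ^ 4 * 5 * ‖t‖ ^ 8 := by
    calc s ^ 8 = s ^ 8 * (‖t‖ ^ 4 * ‖coeff 0 L‖) ^ 2 := by rw [← hL0]; ring
      _ = (s ^ 8 * ‖coeff 0 L‖ ^ 2) * ‖t‖ ^ 8 := by ring
      _ ≤ _ := by gcongr
  norm_num [hs] at h9
  linarith

end PowerSeriesOnDisc

end NIFS

namespace NIFS

/-! ### Uniform transversality for real power series by compactness. -/

section Transversality

open PowerSeries ComplexConjugate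

theorem ρ_pos : 0 < ρ := by
  unfold ρ
  positivity

/-- This identifies `ρ` with the radius in `le_norm_pow_of_double_zero`. -/
theorem ρ_pow_eight : ρ ^ 8 = 256 / 3125 := by
  rw [ρ, mul_pow, ← Real.rpow_natCast ((5 : ℝ) ^ _), ← Real.rpow_mul (by norm_num)]
  norm_num [Real.rpow_neg]

theorem ρ_lt_one : ρ < 1 := by
  by_contra h
  have := one_le_pow₀ (n := 8) (not_lt.1 h)
  rw [ρ_pow_eight] at this
  norm_num at this

/-- The complex power series with the real coefficients `b`. -/
noncomputable def realSeries (b : ℕ → ℝ) : PowerSeries ℂ := PowerSeries.mk fun k => (b k : ℂ)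

/-- The coefficient sequences in `[-1, 1]` that begin with `1`. -/
def unitCoeffs : Set (ℕ → ℝ) := {b | b 0 = 1 ∧ ∀ k, |b k| ≤ 1}

theorem isCompact_unitCoeffs : IsCompact unitCoeffs := by
  have : unitCoeffs = univ.pi (fun _ => Icc (-1 : ℝ) 1) ∩ {b | b 0 = 1} := by
    ext b
    simp only [unitCoeffs, abs_le, Set.mem_pi, mem_inter_iff, mem_ofPred_eq, mem_univ, true_imp_iff,
      mem_Icc]
    exact and_comm
  rw [this]
  exact (isCompact_univ_pi fun _ => isCompact_Icc).inter_right
    (isClosed_eq (continuous_apply 0) continuous_const)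

theorem norm_coeff_realSeries {b : ℕ → ℝ} (hb : b ∈ unitCoeffs) (k : ℕ) :
    ‖coeff k (realSeries b)‖ ≤ 1 := by
  rw [realSeries, coeff_mk, Complex.norm_real]
  exact hb.2 k

theorem boundedCoeff_realSeries {b : ℕ → ℝ} (hb : b ∈ unitCoeffs) :
    BoundedCoeff (realSeries b) := ⟨1, norm_coeff_realSeries hb⟩

theorem conj_ne_of_mem_exampleU {t : ℂ} (ht : t ∈ exampleU) : conj t ≠ t := fun h =>
  ht.2 ⟨t.re, Complex.conj_eq_iff_re.1 h⟩

theorem norm_lt_one_of_mem_exampleU {t : ℂ} (ht : t ∈ exampleU) : ‖t‖ < 1 := ht.1.trans ρ_lt_one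

theorem not_double_zero {b : ℕ → ℝ} (hb : b ∈ unitCoeffs) {t : ℂ} (ht : t ∈ exampleU)
    (hz : evalAt (realSeries b) t = 0) : evalAt (divLinear (realSeries b) t) t ≠ 0 := by
  intro hz'
  have hreal : PowerSeries.map (starRingEnd ℂ) (realSeries b) = realSeries b := by
    ext k
    simp [realSeries]
  have h := le_norm_pow_of_double_zero hreal (by simp [realSeries, hb.1]) (norm_coeff_realSeries hb)
    (norm_lt_one_of_mem_exampleU ht) (conj_ne_of_mem_exampleU ht) hz hz'
  rw [← ρ_pow_eight] at h
  exact absurd ht.1 (not_lt.2 (le_of_pow_le_pow_left₀ (by norm_num) (norm_nonneg t) h))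

/-- Each term involves a single coefficient and is bounded by `ρ ^ k`, so the M-test gives joint
continuity even for the product topology on coefficients, in which `unitCoeffs` is compact. -/
theorem continuousOn_evalAt : ContinuousOn
    (fun q : (ℕ → ℝ) × ℂ × ℂ => evalAt (realSeries q.1) q.2.1)
    (unitCoeffs ×ˢ (exampleU ×ˢ exampleU)) := by
  refine continuousOn_tsum (u := fun k => ρ ^ k) (fun k => ?_)
    (summable_geometric_of_lt_one ρ_pos.le ρ_lt_one) fun k q hq => ?_
  · simp only [realSeries, coeff_mk]
    fun_prop
  · rw [norm_mul, norm_pow]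
    exact (mul_le_of_le_one_left (by positivity) (norm_coeff_realSeries hq.1 k)).trans
      (pow_le_pow_left₀ (norm_nonneg _) hq.2.1.1.le k)

theorem continuousOn_evalAt_divLinear : ContinuousOn
    (fun q : (ℕ → ℝ) × ℂ × ℂ => evalAt (divLinear (realSeries q.1) q.2.1) q.2.2)
    (unitCoeffs ×ˢ (exampleU ×ˢ exampleU)) := by
  have hsum := summable_geometric_of_lt_one ρ_pos.le ρ_lt_one
  have hbound : ∀ k m, ∀ q ∈ unitCoeffs ×ˢ (exampleU ×ˢ exampleU),
      ‖coeff (k + 1 + m) (realSeries q.1) * q.2.1 ^ m‖ ≤ ρ ^ m := by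
    intro k m q hq
    rw [norm_mul, norm_pow]
    exact (mul_le_of_le_one_left (by positivity) (norm_coeff_realSeries hq.1 _)).trans
      (pow_le_pow_left₀ (norm_nonneg _) hq.2.1.1.le m)
  refine continuousOn_tsum (u := fun k => (1 - ρ)⁻¹ * ρ ^ k) (fun k => ?_) (hsum.mul_left _)
    fun k q hq => ?_
  · simp only [divLinear, coeff_mk]
    refine ContinuousOn.mul ?_ (by fun_prop)
    refine continuousOn_tsum (fun m => ?_) hsum (hbound k)
    simp only [realSeries, coeff_mk]
    fun_prop
  · rw [norm_mul, norm_pow, divLinear, coeff_mk]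
    gcongr
    · exact inv_nonneg.2 (sub_nonneg.2 ρ_lt_one.le)
    · exact tsum_of_norm_bounded (hasSum_geometric_of_lt_one ρ_pos.le ρ_lt_one)
        fun m => hbound k m q hq
    · exact hq.2.2.1.le

/-- The absence of double zeros, made uniform: if `x` and `y` are close and `p(x)` is small, the
difference quotient of `p` cannot be small as well. -/
theorem exists_lower_bound {G : Set ℂ} (hG : IsCompact G) (hGU : G ⊆ exampleU) :
    ∃ δ : ℝ, 0 < δ ∧ ∀ b ∈ unitCoeffs, ∀ x ∈ G, ∀ y ∈ G, ‖x - y‖ < δ →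
      ‖evalAt (realSeries b) x‖ < δ →
      δ * ‖x - y‖ ≤ ‖evalAt (realSeries b) x - evalAt (realSeries b) y‖ := by
  set S : Set ((ℕ → ℝ) × ℂ × ℂ) := unitCoeffs ×ˢ (G ×ˢ G)
  have hS : IsCompact S := isCompact_unitCoeffs.prod (hG.prod hG)
  have hSU : S ⊆ unitCoeffs ×ˢ (exampleU ×ˢ exampleU) :=
    prod_mono subset_rfl (prod_mono hGU hGU)
  -- `Φ` vanishes only if `x = y` is a double zero, so it has a positive minimum on the compact set
  -- `S`.
  set Φ : (ℕ → ℝ) × ℂ × ℂ → ℝ := fun q => max ‖q.2.1 - q.2.2‖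
    (max ‖evalAt (realSeries q.1) q.2.1‖ ‖evalAt (divLinear (realSeries q.1) q.2.1) q.2.2‖)
  have hΦ : ContinuousOn Φ S := by
    refine ContinuousOn.sup (by fun_prop) (ContinuousOn.sup ?_ ?_)
    · exact (continuousOn_evalAt.mono hSU).norm
    · exact (continuousOn_evalAt_divLinear.mono hSU).norm
  have hpos : ∀ q ∈ S, 0 < Φ q := by
    intro q hq
    by_contra h
    obtain ⟨h1, h2⟩ := max_le_iff.1 (not_lt.1 h)
    obtain ⟨h2, h3⟩ := max_le_iff.1 h2
    have h4 := sub_eq_zero.1 (norm_le_zero_iff.1 h1)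
    rw [← h4] at h3
    exact not_double_zero hq.1 (hGU hq.2.1) (norm_le_zero_iff.1 h2) (norm_le_zero_iff.1 h3)
  obtain ⟨δ, hδ, hmin⟩ : ∃ δ, 0 < δ ∧ ∀ q ∈ S, δ ≤ Φ q := by
    rcases S.eq_empty_or_nonempty with h | h
    · exact ⟨1, one_pos, by simp [h]⟩
    · obtain ⟨q, hq, hmin⟩ := hS.exists_isMinOn h hΦ
      exact ⟨Φ q, hpos q hq, hmin⟩
  refine ⟨δ, hδ, fun b hb x hx y hy hxy hg => ?_⟩
  have h := hmin (b, x, y) ⟨hb, hx, hy⟩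
  rw [le_max_iff, le_max_iff] at h
  have h := (h.resolve_left (not_le.2 hxy)).resolve_left (not_le.2 hg)
  rw [norm_sub_rev, norm_sub_rev (evalAt _ x),
    evalAt_sub_evalAt (boundedCoeff_realSeries hb) (norm_lt_one_of_mem_exampleU (hGU hx))
      (norm_lt_one_of_mem_exampleU (hGU hy)), norm_mul, mul_comm]
  exact mul_le_mul_of_nonneg_left h (norm_nonneg _)

/-- A map that expands distances at scale `δ` near its almost zeros has few almost zeros. -/
theorem exists_volume_le {G : Set ℂ} (hG : IsCompact G) {δ : ℝ} (hδ : 0 < δ) :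
    ∃ K : ℝ, 0 < K ∧ ∀ g : ℂ → ℂ,
      (∀ x ∈ G, ∀ y ∈ G, ‖x - y‖ < δ → ‖g x‖ < δ → δ * ‖x - y‖ ≤ ‖g x - g y‖) →
      ∀ r : ℝ, 0 < r → volume {t ∈ G | ‖g t‖ ≤ r} ≤ ENNReal.ofReal (K * r ^ 2) := by
  -- Radius `δ / 2` puts any two points of one ball at distance less than `δ`, where the hypothesis
  -- on `g` applies.
  obtain ⟨F, -, hF, hcov⟩ := hG.finite_cover_balls (half_pos hδ)
  lift F to Finset ℂ using hF
  set a : ℝ := F.card * (4 * Real.pi / δ ^ 2)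
  set v : ℝ := volume.real G / δ ^ 2
  have ha : 0 ≤ a := by positivity
  have hv : 0 ≤ v := by positivity
  -- `a` serves for `r < δ`, `v` for `r ≥ δ`, where the measure of `G` suffices; the `1` ensures
  -- positivity.
  refine ⟨a + v + 1, by positivity, fun g hg r hr => ?_⟩
  rcases lt_or_ge r δ with hrδ | hrδ
  · have hpiece : ∀ c ∈ F, volume ({t ∈ G | ‖g t‖ ≤ r} ∩ Metric.ball c (δ / 2)) ≤
        ENNReal.ofReal (4 * Real.pi / δ ^ 2 * r ^ 2) := by
      intro c _
      rcases ({t ∈ G | ‖g t‖ ≤ r} ∩ Metric.ball c (δ / 2)).eq_empty_or_nonempty with h | ⟨x, hx⟩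
      · rw [h, measure_empty]
        exact zero_le
      -- Two almost zeros in one ball satisfy `δ |x - y| ≤ |g x - g y| ≤ 2 r`.
      have hsub : {t ∈ G | ‖g t‖ ≤ r} ∩ Metric.ball c (δ / 2) ⊆
          Metric.closedBall x (2 * r / δ) := by
        intro y hy
        have hd : ‖x - y‖ < δ := by
          rw [← dist_eq_norm]
          have h1 := Metric.mem_ball.1 hx.2
          have h2 := Metric.mem_ball.1 hy.2
          linarith [dist_triangle_right x y c]
        have h3 := hg x hx.1.1 y hy.1.1 hd (hx.1.2.trans_lt hrδ)
        rw [Metric.mem_closedBall, dist_comm, dist_eq_norm, le_div_iff₀ hδ, mul_comm]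
        linarith [norm_sub_le (g x) (g y), hx.1.2, hy.1.2]
      refine (measure_mono hsub).trans (le_of_eq ?_)
      rw [Complex.volume_closedBall, ← ENNReal.ofReal_pow (by positivity),
        ← ENNReal.ofReal_coe_nnreal, ← ENNReal.ofReal_mul (by positivity), NNReal.coe_real_pi]
      congr 1
      field_simp
      ring
    have hsub : {t ∈ G | ‖g t‖ ≤ r} ⊆
        ⋃ c ∈ F, {t ∈ G | ‖g t‖ ≤ r} ∩ Metric.ball c (δ / 2) := by
      intro y hy
      have := hcov hy.1
      simp only [mem_iUnion] at this ⊢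
      obtain ⟨c, hc, hyc⟩ := this
      exact ⟨c, hc, hy, hyc⟩
    calc volume {t ∈ G | ‖g t‖ ≤ r}
        ≤ ∑ c ∈ F, volume ({t ∈ G | ‖g t‖ ≤ r} ∩ Metric.ball c (δ / 2)) :=
          (measure_mono hsub).trans (measure_biUnion_finset_le _ _)
      _ ≤ ∑ _c ∈ F, ENNReal.ofReal (4 * Real.pi / δ ^ 2 * r ^ 2) := Finset.sum_le_sum hpiece
      _ = ENNReal.ofReal (a * r ^ 2) := by
          rw [Finset.sum_const, nsmul_eq_mul, ← ENNReal.ofReal_natCast,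
            ← ENNReal.ofReal_mul (by positivity), ← mul_assoc]
      _ ≤ ENNReal.ofReal ((a + v + 1) * r ^ 2) := by
          gcongr
          linarith
  · calc volume {t ∈ G | ‖g t‖ ≤ r} ≤ volume G := measure_mono fun t ht => ht.1
      _ = ENNReal.ofReal (v * δ ^ 2) := by
          rw [div_mul_cancel₀ _ (by positivity), ofReal_measureReal hG.measure_ne_top]
      _ ≤ ENNReal.ofReal ((a + v + 1) * r ^ 2) := by
          gcongr
          linarith

theorem exists_volume_evalAt_le {G : Set ℂ} (hG : IsCompact G) (hGU : G ⊆ exampleU) :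
    ∃ K : ℝ, 0 < K ∧ ∀ b ∈ unitCoeffs, ∀ r : ℝ, 0 < r →
      volume {t ∈ G | ‖evalAt (realSeries b) t‖ ≤ r} ≤ ENNReal.ofReal (K * r ^ 2) := by
  obtain ⟨δ, hδ, h⟩ := exists_lower_bound hG hGU
  obtain ⟨K, hK, h'⟩ := exists_volume_le hG hδ
  exact ⟨K, hK, fun b hb => h' _ (h b hb)⟩

end Transversality

end NIFS

namespace NIFS

/-! ### Addresses as power series, and the verification of the conditions. -/

section Example

open PowerSeries

theorem exampleMap_apply (t : ℂ) (j : ℕ) (i : Fin 2) (z : ℂ) :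
    exampleMap t j i z = t * z + (i.val : ℂ) / (j : ℂ) := by
  fin_cases i <;> simp [exampleMap]

theorem word_exampleMap (t : ℂ) {n : ℕ} (ω : Tail (fun _ => Fin 2) n) (j : ℕ) (z : ℂ) :
    word (I := fun _ => Fin 2) (exampleMap t) ω j z =
      t ^ j * z + ∑ k ∈ Finset.range j, ((ω k).val : ℂ) / ((n + k : ℕ) : ℂ) * t ^ k := by
  induction j generalizing z with
  | zero => simp [word]
  | succ j ih =>
    rw [word, Function.comp_apply, ih, exampleMap_apply, Finset.sum_range_succ]
    ring

theorem norm_digit_div_le {n : ℕ} (hn : 1 ≤ n) (i : Fin 2) (k : ℕ) :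
    ‖(i.val : ℂ) / ((n + k : ℕ) : ℂ)‖ ≤ 1 := by
  rw [norm_div, Complex.norm_natCast, Complex.norm_natCast]
  have h1 : (i.val : ℝ) ≤ 1 := by exact_mod_cast Nat.lt_succ_iff.1 i.2
  have h2 : (1 : ℝ) ≤ ((n + k : ℕ) : ℝ) := by exact_mod_cast hn.trans (Nat.le_add_right n k)
  exact div_le_one_of_le₀ (h1.trans h2) (by positivity)

/-- The limit of the compositions along `ω`. -/
noncomputable def limitPoint {n : ℕ} (t : ℂ) (ω : Tail (fun _ => Fin 2) n) : ℂ :=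
  ∑' k, ((ω k).val : ℂ) / ((n + k : ℕ) : ℂ) * t ^ k

theorem mem_exampleX_iff {z : ℂ} : z ∈ exampleX ↔ ‖z‖ ≤ (1 - ρ)⁻¹ := by
  rw [exampleX, mem_ofPred_eq, one_div]

theorem inv_one_sub_ρ_pos : 0 < (1 - ρ)⁻¹ := inv_pos.2 (sub_pos.2 ρ_lt_one)

/-- The images of the disc contain the limit point and have diameter at most `2 ρ ^ j / (1 - ρ)`. -/
theorem iInter_word_image {t : ℂ} (ht : t ∈ exampleU) {n : ℕ} (hn : 1 ≤ n)
    (ω : Tail (fun _ => Fin 2) n) :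
    ⋂ j ∈ Ici 1, word (I := fun _ => Fin 2) (exampleMap t) ω j '' exampleX = {limitPoint t ω} := by
  set c : ℕ → ℂ := fun k => ((ω k).val : ℂ) / ((n + k : ℕ) : ℂ) with hc
  have ht1 := norm_lt_one_of_mem_exampleU ht
  have hcb : ∀ k, ‖c k‖ ≤ 1 := fun k => norm_digit_div_le hn (ω k) k
  have hsum : Summable fun k => c k * t ^ k := summable_mul_pow hcb ht1
  have hmem : ∀ j, limitPoint t ω ∈ word (I := fun _ => Fin 2) (exampleMap t) ω j '' exampleX := by
    intro j
    -- The preimage is the series of the shifted word; the radius `1 / (1 - ρ)` is the geometric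
    -- bound for such series.
    refine ⟨∑' k, c (k + j) * t ^ k, ?_, ?_⟩
    · rw [mem_exampleX_iff]
      refine (norm_tsum_mul_pow_le (fun k => hcb (k + j)) ht1).trans ?_
      rw [one_mul]
      exact inv_anti₀ (sub_pos.2 ρ_lt_one) (sub_le_sub_left ht.1.le 1)
    · rw [word_exampleMap, limitPoint, ← hsum.sum_add_tsum_nat_add j, add_comm, ← tsum_mul_left]
      congr 1
      exact tsum_congr fun k => by ring
  refine eq_singleton_iff_unique_mem.2 ⟨mem_iInter₂.2 fun j _ => hmem j, fun x hx => ?_⟩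
  have hle : ∀ j : ℕ, ‖x - limitPoint t ω‖ ≤ ρ ^ (j + 1) * (2 * (1 - ρ)⁻¹) := by
    intro j
    obtain ⟨y, hy, rfl⟩ := mem_iInter₂.1 hx (j + 1) (mem_Ici.2 (Nat.le_add_left 1 j))
    obtain ⟨w, hw, hw'⟩ := hmem (j + 1)
    rw [← hw', word_exampleMap, word_exampleMap, add_sub_add_right_eq_sub, ← mul_sub, norm_mul,
      norm_pow]
    have h1 := mem_exampleX_iff.1 hy
    have h2 := mem_exampleX_iff.1 hw
    have h3 := norm_sub_le y w
    gcongr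
    · exact pow_nonneg ρ_pos.le _
    · exact ht.1.le
    · linarith
  have hlim : Tendsto (fun j : ℕ => ρ ^ (j + 1) * (2 * (1 - ρ)⁻¹)) atTop (𝓝 0) := by
    simpa using ((tendsto_add_atTop_iff_nat 1).2
      (tendsto_pow_atTop_nhds_zero_of_lt_one ρ_pos.le ρ_lt_one)).mul_const (2 * (1 - ρ)⁻¹)
  exact sub_eq_zero.1 (norm_le_zero_iff.1 (ge_of_tendsto' hlim hle))

theorem address_eq_limitPoint {t : ℂ} (ht : t ∈ exampleU) {n : ℕ} (hn : 1 ≤ n)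
    (ω : Tail (fun _ => Fin 2) n) :
    address (I := fun _ => Fin 2) exampleX (exampleMap t) ω = limitPoint t ω := by
  have h := iInter_word_image ht hn ω
  have h' := Classical.epsilon_spec (p := fun x =>
    ⋂ j ∈ Ici 1, word (I := fun _ => Fin 2) (exampleMap t) ω j '' exampleX = {x}) ⟨_, h⟩
  exact (singleton_eq_singleton_iff.1 (h.symm.trans h')).symm

theorem continuousOn_limitPoint {n : ℕ} (hn : 1 ≤ n) :
    ContinuousOn (fun p : ℂ × Tail (fun _ => Fin 2) n => limitPoint p.1 p.2)
      (exampleU ×ˢ univ) := by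
  refine continuousOn_tsum (u := fun k => ρ ^ k) (fun k => ?_)
    (summable_geometric_of_lt_one ρ_pos.le ρ_lt_one) fun k p hp => ?_
  · have h : Continuous fun i : Fin 2 => (i.val : ℂ) := continuous_of_discreteTopology
    have h' : Continuous fun p : ℂ × Tail (fun _ => Fin 2) n => ((p.2 k).val : ℂ) :=
      h.comp ((continuous_apply k).comp continuous_snd)
    exact ((h'.div_const _).mul (continuous_fst.pow k)).continuousOn
  · rw [norm_mul, norm_pow]
    exact (mul_le_of_le_one_left (by positivity) (norm_digit_div_le hn _ k)).trans
      (pow_le_pow_left₀ (norm_nonneg _) hp.1.1.le k)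

/-- Up to sign, `n` times the difference of two addresses with different first letters is a power
series with coefficients in `[-1, 1]` and constant term `1`. -/
theorem exists_realSeries_eq {n : ℕ} (hn : 1 ≤ n) {ω τ : Tail (fun _ => Fin 2) n}
    (h : ω 0 ≠ τ 0) : ∃ b ∈ unitCoeffs, ∀ t : ℂ, ‖t‖ < 1 →
      ‖evalAt (realSeries b) t‖ = n * ‖limitPoint t ω - limitPoint t τ‖ := by
  set c : ℕ → ℝ := fun k => ((ω k).val : ℝ) - ((τ k).val : ℝ) with hc
  have hdigit : ∀ i : Fin 2, 0 ≤ (i.val : ℝ) ∧ (i.val : ℝ) ≤ 1 := fun i =>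
    ⟨by positivity, by exact_mod_cast Nat.lt_succ_iff.1 i.2⟩
  have hc1 : ∀ k, |c k| ≤ 1 := by
    intro k
    have h1 := hdigit (ω k)
    have h2 := hdigit (τ k)
    rw [abs_le]
    constructor <;> simp only [hc] <;> linarith
  have hc0 : c 0 * c 0 = 1 := by
    have : ∀ i j : Fin 2, i ≠ j →
        ((i.val : ℝ) - (j.val : ℝ)) * ((i.val : ℝ) - (j.val : ℝ)) = 1 := by
      intro i j hij
      fin_cases i <;> fin_cases j <;> simp at hij ⊢
    exact this _ _ h
  have hn0 : (0 : ℝ) < n := by exact_mod_cast hn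
  have hc0' : |c 0| = 1 := by
    rw [← abs_mul_self, abs_mul] at hc0
    nlinarith [abs_nonneg (c 0)]
  -- `c 0 = ±1`, so multiplying by it makes the constant term `1`; the factor `n / (n + k) ≤ 1`
  -- keeps the coefficients in `[-1, 1]`.
  refine ⟨fun k => c 0 * c k * (n / ((n + k : ℕ) : ℝ)), ⟨?_, fun k => ?_⟩, fun t ht => ?_⟩
  · simp [hc0, hn0.ne']
  · have h1 : (n : ℝ) / ((n + k : ℕ) : ℝ) ≤ 1 :=
      div_le_one_of_le₀ (by exact_mod_cast Nat.le_add_right n k) (by positivity)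
    rw [abs_mul, abs_mul, hc0', one_mul, abs_of_nonneg (by positivity : 0 ≤ (n : ℝ) / _)]
    exact mul_le_one₀ (hc1 k) (by positivity) h1
  · have hω : Summable fun k => ((ω k).val : ℂ) / ((n + k : ℕ) : ℂ) * t ^ k :=
      summable_mul_pow (fun k => norm_digit_div_le hn (ω k) k) ht
    have hτ : Summable fun k => ((τ k).val : ℂ) / ((n + k : ℕ) : ℂ) * t ^ k :=
      summable_mul_pow (fun k => norm_digit_div_le hn (τ k) k) ht
    have : evalAt (realSeries fun k => c 0 * c k * (n / ((n + k : ℕ) : ℝ))) t =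
        (c 0 : ℂ) * ((n : ℂ) * (limitPoint t ω - limitPoint t τ)) := by
      rw [limitPoint, limitPoint, ← hω.tsum_sub hτ, ← tsum_mul_left, ← tsum_mul_left, evalAt]
      refine tsum_congr fun k => ?_
      rw [realSeries, coeff_mk]
      simp only [hc]
      push_cast
      ring
    rw [this, norm_mul, norm_mul, Complex.norm_real, Real.norm_eq_abs, hc0', one_mul,
      Complex.norm_natCast]

theorem exists_transversalWith {G : Set ℂ} (hG : IsCompact G) (hGU : G ⊆ exampleU) :
    ∃ K : ℝ, 0 < K ∧ TransversalWith (I := fun _ => Fin 2) exampleX exampleMap G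
      (fun n => K * (n : ℝ) ^ 2) := by
  obtain ⟨K, hK, h⟩ := exists_volume_evalAt_le hG hGU
  refine ⟨K, hK, fun n hn ω τ hne r hr => ?_⟩
  obtain ⟨b, hb, hbt⟩ := exists_realSeries_eq hn hne
  have hn0 : (0 : ℝ) < n := by exact_mod_cast hn
  have hsub : {t ∈ G | ‖address (I := fun _ => Fin 2) exampleX (exampleMap t) ω -
      address (I := fun _ => Fin 2) exampleX (exampleMap t) τ‖ ≤ r} ⊆
      {t ∈ G | ‖evalAt (realSeries b) t‖ ≤ n * r} := by
    rintro t ⟨htG, ht⟩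
    refine ⟨htG, ?_⟩
    rw [address_eq_limitPoint (hGU htG) hn, address_eq_limitPoint (hGU htG) hn] at ht
    rw [hbt t (norm_lt_one_of_mem_exampleU (hGU htG))]
    gcongr
  refine (measure_mono hsub).trans ((h b hb _ (by positivity)).trans (le_of_eq ?_))
  rw [Complex.finrank_real_complex]
  congr 1
  ring

theorem tendsto_log_mul_sq_div (K : ℝ) (hK : 0 < K) :
    Tendsto (fun n : ℕ => Real.log (K * (n : ℝ) ^ 2) / n) atTop (𝓝 0) := by
  have h1 : Tendsto (fun n : ℕ => Real.log K / n + 2 * (Real.log n / n)) atTop (𝓝 0) := by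
    have h2 : Tendsto (fun x : ℝ => Real.log x / x) atTop (𝓝 0) := by
      simpa using Real.tendsto_pow_log_div_mul_add_atTop 1 0 1 one_ne_zero
    simpa using (tendsto_const_div_atTop_nhds_zero_nat (Real.log K)).add
      ((h2.comp tendsto_natCast_atTop_atTop).const_mul 2)
  refine h1.congr' ?_
  filter_upwards [eventually_ge_atTop 1] with n hn
  have hn0 : (0 : ℝ) < n := by exact_mod_cast hn
  rw [Real.log_mul hK.ne' (by positivity), Real.log_pow]
  push_cast
  ring

theorem ne_zero_of_mem_exampleU {t : ℂ} (ht : t ∈ exampleU) : t ≠ 0 := fun h =>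
  ht.2 ⟨0, by simp [h]⟩

theorem isOpen_exampleU : IsOpen exampleU :=
  (isOpen_lt continuous_norm continuous_const).inter
    Complex.isometry_ofReal.isClosedEmbedding.isClosed_range.isOpen_compl

theorem nonempty_exampleU : exampleU.Nonempty := by
  refine ⟨((ρ / 2 : ℝ) : ℂ) * Complex.I, ?_, ?_⟩
  · have := ρ_pos
    rw [norm_mul, Complex.norm_I, mul_one, Complex.norm_real, Real.norm_of_nonneg (by positivity)]
    linarith
  · rintro ⟨x, hx⟩
    have := congrArg Complex.im hx
    simp at this
    linarith [ρ_pos]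

theorem exampleX_eq_closedBall : exampleX = Metric.closedBall 0 (1 - ρ)⁻¹ := by
  ext z
  rw [mem_exampleX_iff, mem_closedBall_zero_iff]

/-- The radius `R = 1 / (1 - ρ)` solves `ρ R + 1 = R`. -/
theorem mapsTo_exampleMap {t : ℂ} (ht : t ∈ exampleU) {j : ℕ} (hj : 1 ≤ j) (i : Fin 2) :
    MapsTo (exampleMap t j i) exampleX exampleX := by
  intro z hz
  rw [mem_exampleX_iff] at hz ⊢
  have h1 : ‖(i.val : ℂ) / (j : ℂ)‖ ≤ 1 := norm_digit_div_le hj i 0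
  have h2 : 0 < 1 - ρ := sub_pos.2 ρ_lt_one
  rw [exampleMap_apply]
  calc ‖t * z + (i.val : ℂ) / (j : ℂ)‖ ≤ ‖t‖ * ‖z‖ + 1 := by
        rw [← norm_mul]
        exact (norm_add_le _ _).trans (add_le_add_right h1 _)
    _ ≤ ρ * (1 - ρ)⁻¹ + 1 := by
        gcongr
        · exact ρ_pos.le
        · exact ht.1.le
    _ = (1 - ρ)⁻¹ := by
        field_simp
        ring

theorem hasDerivAt_affine (a c x : ℂ) : HasDerivAt (fun z => a * z + c) a x := by
  simpa using ((hasDerivAt_id x).const_mul a).add_const c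

theorem scaling_affine (a c x : ℂ) : scaling (fun z : ℂ => a * z + c) x = ‖a‖ := by
  have h := (hasDerivAt_affine a c x).hasFDerivAt.restrictScalars ℝ
  rw [scaling, h.fderiv, ContinuousLinearMap.norm_restrictScalars,
    ContinuousLinearMap.norm_toSpanSingleton]

theorem isConformalOn_affine {a : ℂ} (ha : a ≠ 0) (c : ℂ) :
    IsConformalOn (fun z => a * z + c) univ where
  contDiffOn := by fun_prop
  isOpen_image := by
    have : (fun z => a * z + c) '' univ = univ := by
      rw [image_univ, range_eq_univ]
      exact fun w => ⟨(w - c) / a, by field_simp; ring⟩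
    rw [this]
    exact isOpen_univ
  exists_inverse := ⟨fun w => a⁻¹ * (w - c), by fun_prop, fun z _ => by
    change a⁻¹ * (a * z + c - c) = z
    field_simp
    ring⟩
  conformalAt x _ := by
    have h := hasDerivAt_affine a c x
    exact h.differentiableAt.conformalAt (by rwa [h.deriv])

theorem scaling_word_exampleMap (t : ℂ) {n : ℕ} (ω : Tail (fun _ => Fin 2) n) (j : ℕ) (x : ℂ) :
    scaling (word (I := fun _ => Fin 2) (exampleMap t) ω j) x = ‖t‖ ^ j := by
  rw [funext (word_exampleMap t ω j), scaling_affine, norm_pow]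

theorem nonempty_exampleX : exampleX.Nonempty :=
  ⟨0, mem_exampleX_iff.2 (by simpa using ρ_lt_one.le)⟩

theorem scalingSup_word_exampleMap (t : ℂ) {n : ℕ} (ω : Tail (fun _ => Fin 2) n) (j : ℕ) :
    scalingSup (word (I := fun _ => Fin 2) (exampleMap t) ω j) exampleX = ‖t‖ ^ j := by
  rw [scalingSup, image_congr fun x _ => scaling_word_exampleMap t ω j x,
    nonempty_exampleX.image_const, csSup_singleton]

/-- The maps are affine on all of `ℂ`, and a word of length `j` has constant scaling factor `|t| ^
j`. This gives distortion constant `1` and reduces distortion continuity to continuity of `log |t|`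
on `U`, which omits `0`. -/
theorem isConformalExtension_exampleMap :
    IsConformalExtension (I := fun _ => Fin 2) exampleX exampleU exampleMap univ exampleMap where
  isOpen := isOpen_univ
  isConnected := isConnected_univ
  subset := subset_univ _
  extends_map _ _ _ _ _ := eqOn_refl _ _
  conformal t ht j _ i := by
    rw [funext (exampleMap_apply t j i)]
    exact isConformalOn_affine (ne_zero_of_mem_exampleU ht) _
  mapsTo _ _ _ _ _ := mapsTo_univ _ _
  uniform_contraction := by
    refine ⟨ρ, ρ_pos, ρ_lt_one, fun t ht n _ ω j _ x _ => ?_⟩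
    rw [scaling_word_exampleMap]
    exact pow_le_pow_left₀ (norm_nonneg t) ht.1.le j
  bounded_distortion := by
    refine ⟨fun _ => 1, continuousOn_const, fun _ _ => le_rfl,
      fun t _ n _ ω j _ x₁ _ x₂ _ => ?_⟩
    rw [scaling_word_exampleMap, scaling_word_exampleMap, one_mul]
  distortion_continuity := by
    intro η hη t₀ ht₀
    have hcont : ContinuousAt (fun t : ℂ => Real.log ‖t‖) t₀ :=
      continuous_norm.continuousAt.log (norm_ne_zero_iff.2 (ne_zero_of_mem_exampleU ht₀))
    obtain ⟨δ, hδ, h⟩ := Metric.continuousAt_iff.1 hcont η hη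
    -- Halving turns the non-strict bound on `‖t - t₀‖` into the strict one needed for continuity.
    refine ⟨δ / 2, half_pos hδ, fun t ht htδ n _ j _ ω => ?_⟩
    have hlog := h (show dist t t₀ < δ by rw [dist_eq_norm]; linarith)
    rw [Real.dist_eq, abs_lt] at hlog
    have e : ∀ {u : ℂ}, u ∈ exampleU → ‖u‖ ^ j = Real.exp (j * Real.log ‖u‖) := fun {u} hu => by
      rw [Real.exp_nat_mul, Real.exp_log (norm_pos_iff.2 (ne_zero_of_mem_exampleU hu))]
    rw [scalingSup_word_exampleMap, scalingSup_word_exampleMap, e ht₀, e ht, ← Real.exp_sub,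
      ← mul_sub, ← mul_neg, Real.exp_le_exp, Real.exp_le_exp]
    constructor <;> gcongr <;> linarith

theorem isTNCIFS_exampleMap :
    IsTNCIFS (I := fun _ => Fin 2) exampleX exampleU exampleMap where
  nonempty := nonempty_exampleX
  isCompact := exampleX_eq_closedBall ▸ isCompact_closedBall _ _
  convex := exampleX_eq_closedBall ▸ convex_closedBall _ _
  param_nonempty := nonempty_exampleU
  param_isOpen := isOpen_exampleU
  mapsTo _ ht _ hj i := mapsTo_exampleMap ht hj i
  extension := ⟨univ, exampleMap, isConformalExtension_exampleMap⟩
  address_spec t ht n hn ω := by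
    rw [address_eq_limitPoint ht hn]
    exact iInter_word_image ht hn ω
  continuity n hn := (continuousOn_limitPoint hn).congr fun p hp =>
    address_eq_limitPoint hp.1 hn p.2
  transversality G hG hGU := by
    obtain ⟨K, hK, h⟩ := exists_transversalWith hG hGU
    refine ⟨_, fun n hn => ?_, tendsto_log_mul_sq_div K hK, h⟩
    have : (0 : ℝ) < n := by exact_mod_cast hn
    positivity

/-- The maps at level `j` send `y + 1 / (j t)` and `y` to the same point, and for large `j` both
points lie in the interior of `Y`. -/
theorem not_openSetCondition_exampleMap {t : ℂ} (ht : t ∈ exampleU) {Y : Set ℂ}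
    (hY : (interior Y).Nonempty) :
    ¬ OpenSetCondition (I := fun _ => Fin 2) Y (exampleMap t) := by
  intro h
  obtain ⟨y, hy⟩ := hY
  have ht0 := ne_zero_of_mem_exampleU ht
  have hlim : Tendsto (fun j : ℕ => y + (1 : ℂ) / (j : ℂ) / t) atTop (𝓝 y) := by
    simpa using (tendsto_const_nhds (x := y)).add
      ((tendsto_const_div_atTop_nhds_zero_nat (1 : ℂ)).div_const t)
  obtain ⟨j, hj, hj1⟩ := ((hlim.eventually (isOpen_interior.mem_nhds hy)).and
    (eventually_ge_atTop 1)).exists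
  refine (h j hj1 0 1 (by simp)).subset ⟨⟨_, hj, rfl⟩, y, hy, ?_⟩
  rw [exampleMap_apply, exampleMap_apply]
  simp only [Fin.val_zero, Fin.val_one, Nat.cast_zero, Nat.cast_one, zero_div, add_zero, mul_add,
    mul_div_cancel₀ _ ht0]

theorem nonempty_interior_exampleX : (interior exampleX).Nonempty := by
  rw [exampleX_eq_closedBall]
  exact ⟨0, Metric.ball_subset_interior_closedBall (Metric.mem_ball_self inv_one_sub_ρ_pos)⟩

end Example

end NIFS

theorem theoremB :
    NIFS.IsTNCIFS (I := fun _ => Fin 2) NIFS.exampleX NIFS.exampleU NIFS.exampleMap ∧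
    (∀ t ∈ NIFS.exampleU, ∀ Y : Set ℂ, IsCompact Y → (interior Y).Nonempty →
      ¬ NIFS.OpenSetCondition (I := fun _ => Fin 2) Y (NIFS.exampleMap t)) ∧
    (interior NIFS.exampleX).Nonempty ∧
    (∀ G : Set ℂ, IsCompact G → G ⊆ NIFS.exampleU → ∃ K : ℝ, 0 < K ∧
      NIFS.TransversalWith (I := fun _ => Fin 2) NIFS.exampleX NIFS.exampleMap G
        (fun n => K * (n : ℝ) ^ 2)) :=
  ⟨NIFS.isTNCIFS_exampleMap, fun _ ht _ _ hY => NIFS.not_openSetCondition_exampleMap ht hY,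
    NIFS.nonempty_interior_exampleX, fun _ hG hGU => NIFS.exists_transversalWith hG hGU⟩
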